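/- **Theorem (Concentration Around Expected Value).** Let $d_v,d_c\ge 0$ and $\ell\ge 1$ be integers. There is a constant $\beta=\beta(d_v,d_c,\ell)>0$ such that the following holds for all integers $n,m\ge 0$ with $n d_v=m d_c$, all alphabets, all decoder maps and all noise laws described below. *System.* The graph is drawn uniformly from the ensemble of labeled $(d_v,d_c)$-regular bipartite factor graphs with $n$ variable nodes and $m=nd_v/d_c$ check nodes, i.e. it is a uniformly random bijection between the $nd_v$ variable node sockets and the $md_c$ check node sockets. The all-one codeword is sent over a memoryless channel with input alphabet $\{\pm1\}$ and output alphabet $\mathcal Y$, giving independent outputs $y_1,\dots,y_n$. The messages lie in an alphabet $\mathcal M\subseteq[-\infty,\infty]$ and are in belief format: the sign of a message is the bit estimate. The decoder is run for $\ell$ iterations $t=0,\dots,\ell-1$. In iteration $t$ every variable node sends on each of its edges the message $\Psi^{(t)}$ computed from its channel output, from the $d_v-1$ messages received on its other edges in iteration $t-1$, and from a computation noise of the node in $\mathcal U$ (for $t=0$ only from the channel output and the computation noise). A sent message $\nu$ is received as a function $\Xi_{\rm v\to c}(\nu,w)$ of $\nu$ and a wire noise $w\in\mathcal M$. Then every check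 node sends on each of its edges the message $\Phi^{(t)}$ computed from the $d_c-1$ messages just received on its other edges and from a computation noise of the node in $\mathcal U$, and a sent message $\nu$ is received as $\Xi_{\rm c\to v}(\nu,w)$ with a wire noise $w\in\mathcal M$. All these maps are measurable. There is one computation noise for each node and iteration and one wire noise for each edge, direction and iteration; the graph, the channel outputs and all these noises are mutually independent, the laws of the channel and of the noises being otherwise arbitrary. *Conclusion.* Let $Z$ be the number of those among the $nd_v$ edges that hold an incorrect value (one that is not positive) at the end of the last iteration, where the value held by an edge is the message received by its variable node in that iteration. Then $Z$ is integrable and, for every $\epsilon>0$, $$\Pr\left[\,|Z-\mathbb E Z|> n d_v\epsilon/2\,\right]\le 2e^{-\beta\epsilon^2 n}.$$ The same holds, with the same $\beta$, when the value held by an edge is taken to be the message received in the last iteration by its check node. -/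

import Mathlib

open MeasureTheory ProbabilityTheory

namespace NoisyLDPC

noncomputable section

/-- An edge of the factor graph, identified with the socket `(i, a)`, `a < dv`, of the variable
node `i` to which it is attached. -/
abbrev Edge (n dv : ℕ) : Type := Fin n × Fin dv

/-- Labeled bipartite factor graphs with `n` variable nodes of degree `dv` and `m` check nodes of
degree `dc`: every variable socket is joined to exactly one check socket and conversely. -/
def FactorGraph (n m dv dc : ℕ) : Type := (Fin n × Fin dv) ≃ (Fin m × Fin dc)

instance (n m dv dc : ℕ) : MeasurableSpace (FactorGraph n m dv dc) := ⊤

namespace FactorGraph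

variable {n m dv dc : ℕ}

/-- The check socket at the other end of an edge. -/
def checkSocket (g : FactorGraph n m dv dc) (e : Edge n dv) : Fin m × Fin dc := Equiv.toFun g e

/-- The edge attached to a check socket. -/
def edgeAt (g : FactorGraph n m dv dc) (s : Fin m × Fin dc) : Edge n dv := Equiv.invFun g s

end FactorGraph

/-- The `k`-th socket, in increasing order, among the `d - 1` sockets of a node of degree `d`
that differ from the socket `a`. -/
def otherSocket {d : ℕ} (a : Fin d) (k : Fin (d - 1)) : Fin d :=
  ⟨if k.1 < a.1 then k.1 else k.1 + 1, by have := k.2; split <;> omega⟩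

/-- The local maps of a noisy message-passing decoder with message alphabet `M` in belief format
(the sign of a message is the bit estimate, its magnitude, possibly infinite, the confidence),
channel output alphabet `Y` and computation noise alphabet `U`. -/
structure Decoder (M : Set EReal) (Y U : Type*) [MeasurableSpace Y] [MeasurableSpace U]
    (dv dc : ℕ) where
  /-- Variable node map of iteration `0`. -/
  varInit : Y → U → M
  /-- Variable node map of the iterations `t ≥ 1`. -/
  varMap : ℕ → Y → (Fin (dv - 1) → M) → U → M
  /-- Check node map of iteration `t`. -/
  checkMap : ℕ → (Fin (dc - 1) → M) → U → M
  /-- Variable-to-check message wire: received message from sent message and wire noise. -/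
  wireToCheck : M → M → M
  /-- Check-to-variable message wire. -/
  wireToVar : M → M → M
  measurable_varInit : Measurable fun p : Y × U => varInit p.1 p.2
  measurable_varMap : ∀ t,
    Measurable fun p : Y × (Fin (dv - 1) → M) × U => varMap t p.1 p.2.1 p.2.2
  measurable_checkMap : ∀ t, Measurable fun p : (Fin (dc - 1) → M) × U => checkMap t p.1 p.2
  measurable_wireToCheck : Measurable fun p : M × M => wireToCheck p.1 p.2
  measurable_wireToVar : Measurable fun p : M × M => wireToVar p.1 p.2

/-- The laws of the random elements of a system with `n` variable nodes and `m` check nodes that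
is run for `ℓ` iterations (numbered `0, …, ℓ - 1`). -/
structure Noise (M : Set EReal) (Y U : Type*) [MeasurableSpace Y] [MeasurableSpace U]
    (n m dv ℓ : ℕ) where
  /-- Memoryless channel with input alphabet `{1, -1}`: law of the `i`-th output given the `i`-th
  input. -/
  channel : Fin n → ℤˣ → ProbabilityMeasure Y
  /-- Laws of the computation noises in the variable nodes, one for each iteration and node. -/
  varNoise : Fin ℓ × Fin n → ProbabilityMeasure U
  /-- Laws of the computation noises in the check nodes, one for each iteration and node. -/
  checkNoise : Fin ℓ × Fin m → ProbabilityMeasure U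
  /-- Laws of the noises on the variable-to-check wires, one for each iteration and edge. -/
  wireToCheckNoise : Fin ℓ × Edge n dv → ProbabilityMeasure M
  /-- Laws of the noises on the check-to-variable wires, one for each iteration and edge. -/
  wireToVarNoise : Fin ℓ × Edge n dv → ProbabilityMeasure M

/-- Sample space: a graph, the channel outputs, the computation noises in the variable nodes and
in the check nodes, the noises on the variable-to-check and on the check-to-variable wires. -/
abbrev Outcome (M : Set EReal) (Y U : Type*) (n m dv dc ℓ : ℕ) : Type _ :=
  FactorGraph n m dv dc × (Fin n → Y) × (Fin ℓ × Fin n → U) × (Fin ℓ × Fin m → U) ×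
    (Fin ℓ × Edge n dv → M) × (Fin ℓ × Edge n dv → M)

namespace Outcome

variable {M : Set EReal} {Y U : Type*} {n m dv dc ℓ : ℕ}

def graph (ω : Outcome M Y U n m dv dc ℓ) : FactorGraph n m dv dc := ω.1
def output (ω : Outcome M Y U n m dv dc ℓ) : Fin n → Y := ω.2.1
def varNoise (ω : Outcome M Y U n m dv dc ℓ) : Fin ℓ × Fin n → U := ω.2.2.1
def checkNoise (ω : Outcome M Y U n m dv dc ℓ) : Fin ℓ × Fin m → U := ω.2.2.2.1
def wireToCheckNoise (ω : Outcome M Y U n m dv dc ℓ) : Fin ℓ × Edge n dv → M := ω.2.2.2.2.1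
def wireToVarNoise (ω : Outcome M Y U n m dv dc ℓ) : Fin ℓ × Edge n dv → M := ω.2.2.2.2.2

end Outcome

section Law

variable {M : Set EReal} {Y U : Type*} [MeasurableSpace Y] [MeasurableSpace U] {n m dv ℓ : ℕ}

/-- The joint law when the all-one codeword is sent: the graph is uniform on the ensemble, and the
graph, the channel outputs and all decoder noises are independent. -/
def law (N : Noise M Y U n m dv ℓ) (dc : ℕ) : Measure (Outcome M Y U n m dv dc ℓ) :=
  (uniformOn (Set.univ : Set (FactorGraph n m dv dc))).prod <|
    (Measure.pi fun i => (N.channel i 1 : Measure Y)).prod <|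
    (Measure.pi fun i => (N.varNoise i : Measure U)).prod <|
    (Measure.pi fun i => (N.checkNoise i : Measure U)).prod <|
    (Measure.pi fun i => (N.wireToCheckNoise i : Measure M)).prod <|
    Measure.pi fun i => (N.wireToVarNoise i : Measure M)

end Law

namespace Decoder

variable {M : Set EReal} {Y U : Type*} [MeasurableSpace Y] [MeasurableSpace U]
  {n m dv dc ℓ : ℕ}

/-- The message sent by the variable node of the edge `e` in iteration `t ≥ 1`, when `μ` is the
family of the check-to-variable messages received in iteration `t - 1`; only the messages received
on the other edges of that node are used. -/
def varSend (D : Decoder M Y U dv dc) (ω : Outcome M Y U n m dv dc ℓ) (t : ℕ) (ht : t < ℓ)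
    (μ : Edge n dv → M) (e : Edge n dv) : M :=
  D.varMap t (ω.output e.1) (fun k => μ (e.1, otherSocket e.2 k)) (ω.varNoise (⟨t, ht⟩, e.1))

/-- The message sent by the check node of the edge `e` in iteration `t`, when `μ` is the family of
the variable-to-check messages received in iteration `t`. -/
def checkSend (D : Decoder M Y U dv dc) (ω : Outcome M Y U n m dv dc ℓ) (t : ℕ) (ht : t < ℓ)
    (μ : Edge n dv → M) (e : Edge n dv) : M :=
  D.checkMap t
    (fun k => μ (ω.graph.edgeAt
      ((ω.graph.checkSocket e).1, otherSocket (ω.graph.checkSocket e).2 k)))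
    (ω.checkNoise (⟨t, ht⟩, (ω.graph.checkSocket e).1))

/-- The variable-to-check message received, after wire noise, on the edge `e`, given the messages
`ν` sent in iteration `t`. -/
def receiveAtCheck (D : Decoder M Y U dv dc) (ω : Outcome M Y U n m dv dc ℓ) (t : ℕ) (ht : t < ℓ)
    (ν : Edge n dv → M) (e : Edge n dv) : M :=
  D.wireToCheck (ν e) (ω.wireToCheckNoise (⟨t, ht⟩, e))

/-- The check-to-variable message received, after wire noise, on the edge `e`, given the messages
`ν` sent in iteration `t`. -/
def receiveAtVar (D : Decoder M Y U dv dc) (ω : Outcome M Y U n m dv dc ℓ) (t : ℕ) (ht : t < ℓ)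
    (ν : Edge n dv → M) (e : Edge n dv) : M :=
  D.wireToVar (ν e) (ω.wireToVarNoise (⟨t, ht⟩, e))

/-- The messages received in iteration `t` over all edges, as a pair: first the
variable-to-check messages, then the check-to-variable messages. -/
def received (D : Decoder M Y U dv dc) (ω : Outcome M Y U n m dv dc ℓ) :
    (t : ℕ) → t < ℓ → (Edge n dv → M) × (Edge n dv → M)
  | 0, ht =>
    let toCheck := D.receiveAtCheck ω 0 ht
      fun e => D.varInit (ω.output e.1) (ω.varNoise (⟨0, ht⟩, e.1))
    (toCheck, D.receiveAtVar ω 0 ht (D.checkSend ω 0 ht toCheck))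
  | t + 1, ht =>
    let toCheck := D.receiveAtCheck ω (t + 1) ht
      (D.varSend ω (t + 1) ht (D.received ω t (Nat.lt_of_succ_lt ht)).2)
    (toCheck, D.receiveAtVar ω (t + 1) ht (D.checkSend ω (t + 1) ht toCheck))

end Decoder

open Classical in
/-- The number of edges with an incorrect value: the all-one codeword is sent, so a message is
correct when its sign is positive. -/
def numIncorrect {M : Set EReal} {n dv : ℕ} (μ : Edge n dv → M) : ℕ :=
  (Finset.univ.filter fun e => ¬ (0 : EReal) < (μ e : EReal)).card

/-- The two directions in which an edge carries messages. -/
inductive Direction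
  | toVar
  | toCheck

/-- The number `Z` of edges that hold an incorrect value at the end of the last of the `ℓ`
iterations. For `d = toVar` the value held by an edge is the message received by its variable
node, for `d = toCheck` it is the message received by its check node. -/
def incorrectValues {M : Set EReal} {Y U : Type*} [MeasurableSpace Y] [MeasurableSpace U]
    {n m dv dc ℓ : ℕ} (D : Decoder M Y U dv dc) (hℓ : 0 < ℓ) (d : Direction)
    (ω : Outcome M Y U n m dv dc ℓ) : ℝ :=
  match d with
  | .toVar => numIncorrect (D.received ω (ℓ - 1) (Nat.sub_lt hℓ Nat.one_pos)).2
  | .toCheck => numIncorrect (D.received ω (ℓ - 1) (Nat.sub_lt hℓ Nat.one_pos)).1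

end

end NoisyLDPC

/-!
The number `Z` of incorrect values is a function of the random graph and of independent noise
variables, `O(n)` in all, and it has bounded differences, with bounds independent of `n`: this is
McDiarmid's inequality, adapted to include a uniformly random bijection.

*Bounded differences.* Within one iteration a message depends only on the messages on edges sharing
a node with its edge, and each node has at most `dv` or `dc` edges. Changing boundedly many values
of the graph and of each noise family therefore changes at most `NoisyLDPC.spread dv dc t`
variable-to-check messages in iteration `t`, and a comparable number of check-to-variable messages
(`NoisyLDPC.Decoder.ncard_received_ne_le`), whatever the decoder maps are.

*Concentration.* Rather than with a martingale, the sub-Gaussian bound is obtained by tensorization: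
`BoundedDifferences.Concentrates μ R V` says that functions varying by at most `1` along the moves
`R` have variance proxy `V`. Hoeffding's lemma gives `V = 1 / 4` for a single coordinate, and
`BoundedDifferences.Concentrates.prod` adds proxies over products, so that neither conditional
expectations nor any regularity of the alphabets is needed. A uniform bijection between sets of
size `N` fits in because a uniform permutation is a product of `N` independent random
transpositions, and resampling one of them changes the permutation at no more than three points
(`BoundedDifferences.concentrates_perm`).

A graph with edges has `m ≤ n * dv`, so the total proxy is `O(n)` and the Chernoff bound gives the
claim. In a graph without edges, where `m` may be arbitrarily large, `Z = 0`.
-/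

/-! ### Sub-Gaussian concentration of functions with bounded differences -/

namespace BoundedDifferences

open Real
open scoped NNReal

/-- `Concentrates μ R V` says that every bounded measurable function on `Ω` that varies by at most
`1` along each move `R x y` is, after centering, sub-Gaussian under `μ` with variance proxy `V`. -/
def Concentrates {Ω : Type*} [MeasurableSpace Ω] (μ : Measure Ω) (R : Ω → Ω → Prop) (V : ℝ≥0) :
    Prop :=
  ∀ F : Ω → ℝ, Measurable F → (∃ B, ∀ x, |F x| ≤ B) → (∀ x y, R x y → |F x - F y| ≤ 1) →
    HasSubgaussianMGF (fun x => F x - ∫ z, F z ∂μ) V μ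

section General

variable {Ω Ω' : Type*} [MeasurableSpace Ω] [MeasurableSpace Ω'] {μ : Measure Ω}
  {ν : Measure Ω'} {R : Ω → Ω → Prop} {S : Ω' → Ω' → Prop} {V W : ℝ≥0}

theorem Concentrates.map (h : Concentrates μ R V) {φ : Ω → Ω'} (hφ : MeasurePreserving φ μ ν)
    (hRS : ∀ x y, R x y → S (φ x) (φ y)) : Concentrates ν S V := by
  rintro F hF ⟨B, hB⟩ hS
  have key := h (F ∘ φ) (hF.comp hφ.measurable) ⟨B, fun x => hB _⟩
    fun x y hxy => hS _ _ (hRS x y hxy)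
  have hmean : ∫ z, F z ∂ν = ∫ z, (F ∘ φ) z ∂μ := by
    rw [← hφ.map_eq, integral_map hφ.aemeasurable hF.aestronglyMeasurable]; rfl
  have hφm := hφ.measurable
  rw [← HasSubgaussianMGF.id_map_iff (Measurable.aemeasurable (by fun_prop))] at key ⊢
  convert key using 1
  rw [hmean, ← hφ.map_eq, Measure.map_map (by fun_prop) hφ.measurable]
  rfl

theorem concentrates_of_subsingleton [Subsingleton Ω] [IsProbabilityMeasure μ] :
    Concentrates μ R 0 := by
  intro F _ _ _
  have h0 : ∀ x, F x - ∫ z, F z ∂μ = 0 := fun x => by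
    rw [integral_congr_ae (ae_of_all μ fun y => congrArg F (Subsingleton.elim y x))]
    simp
  simp only [h0]
  exact HasSubgaussianMGF.fun_zero

/-- Hoeffding's lemma: a function with oscillation at most `1` has variance proxy `1 / 4`. -/
theorem concentrates_of_forall [IsProbabilityMeasure μ] (hR : ∀ x y, R x y) :
    Concentrates μ R (1 / 4) := by
  rintro F hF ⟨B, hB⟩ hF1
  have : Nonempty Ω := nonempty_of_isProbabilityMeasure μ
  have hbdd : BddBelow (Set.range F) := ⟨-B, by rintro _ ⟨x, rfl⟩; exact (abs_le.1 (hB x)).1⟩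
  have hmem : ∀ x, F x ∈ Set.Icc (⨅ y, F y) ((⨅ y, F y) + 1) := fun x => by
    refine ⟨ciInf_le hbdd x, ?_⟩
    have : F x - 1 ≤ ⨅ y, F y :=
      le_ciInf fun y => by linarith [(abs_le.1 (hF1 x y (hR x y))).2]
    linarith
  have := hasSubgaussianMGF_of_mem_Icc hF.aemeasurable (ae_of_all μ hmem)
  convert this using 1
  simp only [add_sub_cancel_left, nnnorm_one]
  norm_num

/-- Tensorization: variance proxies add up on a product space whose moves change one of the two
factors. A function on the product is split into its conditional mean given the first factor and
the fluctuation around that mean. -/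
theorem Concentrates.prod [IsProbabilityMeasure μ] [IsProbabilityMeasure ν]
    (hμ : Concentrates μ R V) (hν : Concentrates ν S W) {T : Ω × Ω' → Ω × Ω' → Prop}
    (hT₁ : ∀ a a' b, R a a' → T (a, b) (a', b)) (hT₂ : ∀ a b b', S b b' → T (a, b) (a, b')) :
    Concentrates (μ.prod ν) T (V + W) := by
  rintro F hF ⟨B, hB⟩ hFT
  have hsec : ∀ a, Measurable fun b => F (a, b) := fun a => hF.comp measurable_prodMk_left
  have hint : ∀ a, Integrable (fun b => F (a, b)) ν := fun a =>
    Integrable.of_bound (hsec a).aestronglyMeasurable B (ae_of_all _ fun b => hB (a, b))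
  have hFint : Integrable F (μ.prod ν) :=
    Integrable.of_bound hF.aestronglyMeasurable B (ae_of_all _ hB)
  set g : Ω → ℝ := fun a => ∫ b, F (a, b) ∂ν with hg
  have hgm : Measurable g := (hF.stronglyMeasurable.integral_prod_right').measurable
  have hgB : ∀ a, |g a| ≤ B := fun a => by
    simpa using norm_integral_le_of_norm_le_const (μ := ν) (f := fun b => F (a, b))
      (ae_of_all _ fun b => hB (a, b))
  have hgR : ∀ a a', R a a' → |g a - g a'| ≤ 1 := fun a a' haa => by
    rw [hg]
    simp only
    rw [← integral_sub (hint a) (hint a')]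
    simpa using norm_integral_le_of_norm_le_const (μ := ν) (f := fun b => F (a, b) - F (a', b))
      (ae_of_all _ fun b => hFT _ _ (hT₁ a a' b haa))
  have h₁ := hμ g hgm ⟨B, hgB⟩ hgR
  have h₂ := fun a => hν (fun b => F (a, b)) (hsec a) ⟨B, fun b => hB _⟩
    fun b b' hbb => hFT _ _ (hT₂ a b b' hbb)
  have hmean : ∫ z, F z ∂μ.prod ν = ∫ a, g a ∂μ := integral_prod F hFint
  rw [hmean]
  set e : ℝ := ∫ a, g a ∂μ
  have hexp : ∀ t : ℝ, Integrable (fun z => exp (t * (F z - e))) (μ.prod ν) := fun t =>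
    Integrable.of_bound (by fun_prop) (exp (|t| * (B + |e|))) (ae_of_all _ fun z => by
      rw [norm_eq_abs, abs_exp]
      refine exp_le_exp.2 ((le_abs_self _).trans ?_)
      rw [abs_mul]
      exact mul_le_mul_of_nonneg_left ((abs_sub _ _).trans (by linarith [hB z])) (abs_nonneg t))
  refine ⟨hexp, fun t => ?_⟩
  have hinner : ∀ a, ∫ b, exp (t * (F (a, b) - e)) ∂ν ≤
      exp (W * t ^ 2 / 2) * exp (t * (g a - e)) := fun a => by
    have := (h₂ a).mgf_le t
    rw [mgf] at this
    calc ∫ b, exp (t * (F (a, b) - e)) ∂ν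
        = ∫ b, exp (t * (F (a, b) - g a)) * exp (t * (g a - e)) ∂ν := by
          congr 1 with b; rw [← exp_add]; ring_nf
      _ = (∫ b, exp (t * (F (a, b) - g a)) ∂ν) * exp (t * (g a - e)) := integral_mul_const _ _
      _ ≤ _ := mul_le_mul_of_nonneg_right this (exp_pos _).le
  calc mgf (fun z => F z - e) (μ.prod ν) t
      = ∫ a, ∫ b, exp (t * (F (a, b) - e)) ∂ν ∂μ := integral_prod _ (hexp t)
    _ ≤ ∫ a, exp (W * t ^ 2 / 2) * exp (t * (g a - e)) ∂μ :=
        integral_mono (hexp t).integral_prod_left ((h₁.integrable_exp_mul t).const_mul _) hinner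
    _ = exp (W * t ^ 2 / 2) * mgf (fun a => g a - e) μ t := integral_const_mul _ _
    _ ≤ exp (W * t ^ 2 / 2) * exp (V * t ^ 2 / 2) :=
        mul_le_mul_of_nonneg_left (h₁.mgf_le t) (exp_pos _).le
    _ = exp (↑(V + W) * t ^ 2 / 2) := by rw [← exp_add]; push_cast; ring_nf

/-- Two-sided Chernoff bound for a function that varies by at most `C` along each move. -/
theorem Concentrates.measureReal_abs_sub_gt_le [IsProbabilityMeasure μ] (h : Concentrates μ R V)
    {F : Ω → ℝ} (hF : Measurable F) {B C : ℝ} (hB : ∀ x, |F x| ≤ B) (hC : 0 < C)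
    (hR : ∀ x y, R x y → |F x - F y| ≤ C) {r : ℝ} (hr : 0 ≤ r) :
    μ.real {x | r < |F x - ∫ z, F z ∂μ|} ≤ 2 * exp (-(r / C) ^ 2 / (2 * V)) := by
  have key := h (fun x => F x / C) (hF.div_const C)
    ⟨B / C, fun x => by rw [abs_div, abs_of_pos hC]; gcongr; exact hB x⟩
    fun x y hxy => by
      rw [← sub_div, abs_div, abs_of_pos hC, div_le_one hC]; exact hR x y hxy
  have h₁ := key.measure_ge_le (ε := r / C) (by positivity)
  have h₂ := key.neg.measure_ge_le (ε := r / C) (by positivity)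
  rw [two_mul]
  refine le_trans ?_ (add_le_add h₁ h₂)
  refine (measureReal_mono ?_).trans (measureReal_union_le _ _)
  intro x hx
  simp only [Set.mem_ofPred_eq, Set.mem_union, Pi.neg_apply, integral_div, ← sub_div, ← neg_div]
    at hx ⊢
  rw [div_le_div_iff_of_pos_right hC, div_le_div_iff_of_pos_right hC]
  exact le_abs.1 hx.le

end General

/-! ### Product measures -/

theorem concentrates_pi_fin {X : Type*} [MeasurableSpace X] {k : ℕ} (hk : 1 ≤ k) :
    ∀ (n : ℕ) (μ : Fin n → Measure X) [∀ i, IsProbabilityMeasure (μ i)],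
      Concentrates (Measure.pi μ) (fun x y => {i | x i ≠ y i}.ncard ≤ k) (n / 4)
  | 0, μ, _ => by
    simpa using concentrates_of_subsingleton
  | n + 1, μ, _ => by
    have hsplit := (measurePreserving_piFinSuccAbove μ 0).symm
    have ih := concentrates_pi_fin hk n fun j => μ ((0 : Fin (n + 1)).succAbove j)
    have h1 : Concentrates (μ 0) (fun _ _ => True) (1 / 4) := concentrates_of_forall (by simp)
    have := (h1.prod ih (T := fun p q => ({i | (Fin.cons p.1 p.2 : Fin (n + 1) → X) i ≠
      (Fin.cons q.1 q.2 : Fin (n + 1) → X) i}).ncard ≤ k) ?_ ?_).map hsplit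
      (S := fun x y => {i | x i ≠ y i}.ncard ≤ k) ?_
    · convert this using 1
      push_cast
      ring
    · intro a a' b _
      refine le_trans (Set.ncard_le_ncard (t := {0}) ?_) (by simpa using hk)
      intro i hi
      induction i using Fin.cases with
      | zero => rfl
      | succ j => simp at hi
    · intro a b b' hbb
      refine le_trans ?_ hbb
      rw [← Set.ncard_image_of_injective _ (Fin.succ_injective n)]
      refine Set.ncard_le_ncard ?_
      intro i hi
      induction i using Fin.cases with
      | zero => simp at hi
      | succ j => exact ⟨j, by simpa using hi, rfl⟩
    · intro p q hpq
      simpa [MeasurableEquiv.piFinSuccAbove, Fin.insertNthEquiv, Fin.insertNth_zero'] using hpq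

/-- McDiarmid's bounded differences inequality, in sub-Gaussian form. -/
theorem concentrates_pi {ι X : Type*} [Fintype ι] [MeasurableSpace X] (μ : ι → Measure X)
    [∀ i, IsProbabilityMeasure (μ i)] {k : ℕ} (hk : 1 ≤ k) :
    Concentrates (Measure.pi μ) (fun x y => {i | x i ≠ y i}.ncard ≤ k)
      (Fintype.card ι / 4) := by
  refine (concentrates_pi_fin hk _ fun i => μ ((Fintype.equivFin ι).symm i)).map
    (measurePreserving_piCongrLeft μ (Fintype.equivFin ι).symm) ?_
  intro x y hxy
  refine le_trans ?_ hxy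
  rw [← Set.ncard_image_of_injective _ (Fintype.equivFin ι).symm.injective]
  refine Set.ncard_le_ncard ?_
  intro i hi
  refine ⟨Fintype.equivFin ι i, ?_, by simp⟩
  obtain ⟨j, rfl⟩ := (Fintype.equivFin ι).symm.surjective i
  simpa [MeasurableEquiv.coe_piCongrLeft, Equiv.piCongrLeft_apply_apply] using hi

/-! ### Uniform random bijections -/

theorem measurePreserving_uniformOn_univ {A B : Type*} [Finite A] [Nonempty A]
    [MeasurableSpace A] [MeasurableSpace B] [DiscreteMeasurableSpace A]
    [DiscreteMeasurableSpace B] (e : A ≃ B) :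
    MeasurePreserving e (uniformOn Set.univ) (uniformOn Set.univ) := by
  have := Fintype.ofFinite A
  have := Fintype.ofEquiv A e
  refine ⟨.of_discrete, Measure.ext_of_singleton fun b => ?_⟩
  rw [Measure.map_apply .of_discrete .of_discrete, uniformOn_univ, uniformOn_univ,
    ← Equiv.image_symm_eq_preimage, Set.image_singleton, Measure.count_singleton,
    Measure.count_singleton, Fintype.card_congr e]

theorem uniformOn_univ_prod {A B : Type*} [Finite A] [Finite B] [Nonempty A] [Nonempty B]
    [MeasurableSpace A] [MeasurableSpace B] [DiscreteMeasurableSpace A]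
    [DiscreteMeasurableSpace B] :
    (uniformOn (Set.univ : Set A)).prod (uniformOn (Set.univ : Set B)) =
      uniformOn (Set.univ : Set (A × B)) := by
  have := Fintype.ofFinite A
  have := Fintype.ofFinite B
  refine Measure.ext_of_singleton fun p => ?_
  rw [← Set.singleton_prod_singleton, Measure.prod_prod, Set.singleton_prod_singleton,
    uniformOn_univ, uniformOn_univ, uniformOn_univ, Measure.count_singleton,
    Measure.count_singleton, Measure.count_singleton, Fintype.card_prod, one_div, one_div, one_div,
    Nat.cast_mul, ENNReal.mul_inv (by simp) (by simp)]

/-- Permutations carry the discrete σ-algebra. -/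
instance permMeasurableSpace (n : ℕ) : MeasurableSpace (Equiv.Perm (Fin n)) := ⊤

instance permDiscreteMeasurableSpace (n : ℕ) : DiscreteMeasurableSpace (Equiv.Perm (Fin n)) :=
  ⟨fun _ => trivial⟩

/-- A uniform permutation of `Fin (n + 1)` is the product of an independent uniform transposition
`swap 0 p` and a uniform permutation fixing `0`. Resampling `p` moves at most the three points sent
to `0` or to one of the two values of `p` by the other factor. -/
theorem concentrates_perm : ∀ n : ℕ, Concentrates (uniformOn (Set.univ : Set (Equiv.Perm (Fin n))))
    (fun σ τ => {i | σ i ≠ τ i}.ncard ≤ 3) (n / 4)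
  | 0 => by simpa using concentrates_of_subsingleton
  | n + 1 => by
    have ih := concentrates_perm n
    have h1 : Concentrates (uniformOn (Set.univ : Set (Fin (n + 1)))) (fun _ _ => True) (1 / 4) :=
      concentrates_of_forall (by simp)
    have hm := measurePreserving_uniformOn_univ (Equiv.Perm.decomposeFin (n := n)).symm
    rw [← uniformOn_univ_prod] at hm
    have := (h1.prod ih (T := fun p q => {i | Equiv.Perm.decomposeFin.symm p i ≠
      Equiv.Perm.decomposeFin.symm q i}.ncard ≤ 3) ?_ ?_).map hm
      (S := fun σ τ => {i | σ i ≠ τ i}.ncard ≤ 3) fun p q hpq => hpq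
    · convert this using 1
      push_cast
      ring
    · intro p q σ _
      -- Up to the two transpositions, both permutations are the extension `s` of `σ` fixing `0`.
      set s := Equiv.Perm.decomposeFin.symm ((0 : Fin (n + 1)), σ) with hs
      have key : ∀ (p : Fin (n + 1)) i,
          Equiv.Perm.decomposeFin.symm (p, σ) i = Equiv.swap 0 p (s i) := fun p i => by
        induction i using Fin.cases with
        | zero => simp [hs]
        | succ j => simp [hs]
      refine le_trans (Set.ncard_le_ncard
        (t := ({s.symm 0, s.symm p, s.symm q} : Set (Fin (n + 1)))) ?_) ?_
      · intro i hi
        by_contra hne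
        simp only [Set.mem_insert_iff, Set.mem_singleton_iff, not_or, Equiv.eq_symm_apply] at hne
        obtain ⟨h0, hp, hq⟩ := hne
        exact hi (by rw [key p, key q, Equiv.swap_apply_of_ne_of_ne h0 hp,
          Equiv.swap_apply_of_ne_of_ne h0 hq])
      · refine (Set.ncard_insert_le _ _).trans ?_
        have := Set.ncard_insert_le (s.symm p) {s.symm q}
        rw [Set.ncard_singleton] at this
        omega
    · intro p σ τ hστ
      refine le_trans ?_ hστ
      rw [← Set.ncard_image_of_injective _ (Fin.succ_injective n)]
      refine Set.ncard_le_ncard ?_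
      intro i hi
      induction i using Fin.cases with
      | zero => simp at hi
      | succ j => exact ⟨j, by simpa using hi, rfl⟩

/-- Concentration for a uniform random bijection, where a move changes at most three values. -/
theorem concentrates_equiv {α β : Type*} [Fintype α] [Fintype β] [MeasurableSpace (α ≃ β)]
    [DiscreteMeasurableSpace (α ≃ β)] (e : α ≃ β) :
    Concentrates (uniformOn (Set.univ : Set (α ≃ β)))
      (fun f g => {i | f i ≠ g i}.ncard ≤ 3) (Fintype.card α / 4) := by
  set c := Fintype.equivFin α
  refine (concentrates_perm (Fintype.card α)).map
    (measurePreserving_uniformOn_univ (c.symm.equivCongr (c.symm.trans e))) ?_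
  intro σ τ h
  refine le_trans ?_ h
  rw [← Set.ncard_image_of_injective _ c.symm.injective]
  refine Set.ncard_le_ncard ?_
  intro i hi
  exact ⟨c i, by simpa using hi, by simp⟩

end BoundedDifferences

/-! ### Locality of the decoder -/

namespace NoisyLDPC

section Locality

theorem ncard_le_mul_of_subset_image {α β : Type*} [Finite α] {k : ℕ} {S : Set β} {T : Set α}
    (f : α × Fin k → β) (h : S ⊆ f '' (T ×ˢ Set.univ)) : S.ncard ≤ k * T.ncard := by
  refine (Set.ncard_le_ncard h (Set.toFinite _)).trans
    ((Set.ncard_image_le (Set.toFinite _)).trans ?_)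
  rw [Set.ncard_prod, Set.ncard_univ, Nat.card_eq_fintype_card, Fintype.card_fin, mul_comm]

variable {M : Set EReal} {Y U : Type*} {n m dv dc ℓ : ℕ}

/-- Edges attached to one of the variable nodes in `T`. -/
theorem ncard_setOf_fst_mem_le (T : Set (Fin n)) : {e : Edge n dv | e.1 ∈ T}.ncard ≤ dv * T.ncard :=
  ncard_le_mul_of_subset_image id fun e he => ⟨e, ⟨he, trivial⟩, rfl⟩

/-- Edges that share their variable node with an edge in `T`. -/
theorem ncard_setOf_exists_mem_le (T : Set (Edge n dv)) :
    {e : Edge n dv | ∃ a, (e.1, a) ∈ T}.ncard ≤ dv * T.ncard :=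
  ncard_le_mul_of_subset_image (fun p => (p.1.1, p.2))
    fun e ⟨a, ha⟩ => ⟨((e.1, a), e.2), ⟨ha, trivial⟩, rfl⟩

namespace FactorGraph

@[simp]
theorem checkSocket_edgeAt (g : FactorGraph n m dv dc) (s : Fin m × Fin dc) :
    g.checkSocket (g.edgeAt s) = s := Equiv.apply_symm_apply (α := Edge n dv) g s

@[simp]
theorem edgeAt_checkSocket (g : FactorGraph n m dv dc) (e : Edge n dv) :
    g.edgeAt (g.checkSocket e) = e := Equiv.symm_apply_apply (β := Fin m × Fin dc) g e

theorem edgeAt_injective (g : FactorGraph n m dv dc) : Function.Injective g.edgeAt :=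
  Function.LeftInverse.injective g.checkSocket_edgeAt

/-- Edges attached to one of the check nodes in `T`. -/
theorem ncard_setOf_checkSocket_fst_mem_le (g : FactorGraph n m dv dc) (T : Set (Fin m)) :
    {e : Edge n dv | (g.checkSocket e).1 ∈ T}.ncard ≤ dc * T.ncard :=
  ncard_le_mul_of_subset_image g.edgeAt
    fun e he => ⟨g.checkSocket e, ⟨he, trivial⟩, g.edgeAt_checkSocket e⟩

/-- Edges that share their check node with a socket in `T`. -/
theorem ncard_setOf_exists_checkSocket_mem_le (g : FactorGraph n m dv dc)
    (T : Set (Fin m × Fin dc)) :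
    {e : Edge n dv | ∃ b, ((g.checkSocket e).1, b) ∈ T}.ncard ≤ dc * T.ncard :=
  ncard_le_mul_of_subset_image (fun p => g.edgeAt (p.1.1, p.2))
    fun e ⟨b, hb⟩ => ⟨(((g.checkSocket e).1, b), (g.checkSocket e).2), ⟨hb, trivial⟩,
      g.edgeAt_checkSocket e⟩

/-- Two graphs disagree at as many check sockets as edges: a check socket at which they disagree is
joined by the first graph to an edge at which they disagree. -/
theorem ncard_edgeAt_ne_le (g g' : FactorGraph n m dv dc) :
    {s | g.edgeAt s ≠ g'.edgeAt s}.ncard ≤ {e | g.checkSocket e ≠ g'.checkSocket e}.ncard := by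
  rw [← Set.ncard_image_of_injective _ g.edgeAt_injective]
  refine Set.ncard_le_ncard ?_ (Set.toFinite _)
  rintro _ ⟨s, hs, rfl⟩ heq
  refine hs ?_
  rw [checkSocket_edgeAt] at heq
  conv_rhs => rw [heq, edgeAt_checkSocket]

end FactorGraph

/-- Two outcomes are near when each of their six components differs in at most three places. Three
is what resampling one coordinate of the random graph costs; a noise coordinate costs only one. -/
structure Outcome.Near (ω ω' : Outcome M Y U n m dv dc ℓ) : Prop where
  graph : {e | ω.graph.checkSocket e ≠ ω'.graph.checkSocket e}.ncard ≤ 3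
  output : {i | ω.output i ≠ ω'.output i}.ncard ≤ 3
  varNoise : {i | ω.varNoise i ≠ ω'.varNoise i}.ncard ≤ 3
  checkNoise : {i | ω.checkNoise i ≠ ω'.checkNoise i}.ncard ≤ 3
  wireToCheckNoise : {i | ω.wireToCheckNoise i ≠ ω'.wireToCheckNoise i}.ncard ≤ 3
  wireToVarNoise : {i | ω.wireToVarNoise i ≠ ω'.wireToVarNoise i}.ncard ≤ 3

/-- The disagreements of two noise families within one iteration. -/
theorem ncard_slice_le {κ X : Type*} [Finite κ] (x y : Fin ℓ × κ → X) (t : Fin ℓ) :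
    {i | x (t, i) ≠ y (t, i)}.ncard ≤ {p | x p ≠ y p}.ncard := by
  rw [← Set.ncard_image_of_injective _ (Prod.mk_right_injective t)]
  refine Set.ncard_le_ncard ?_ (Set.toFinite _)
  rintro _ ⟨i, hi, rfl⟩
  exact hi

namespace Decoder

/-- Edges at variable nodes whose channel output or computation noise differs. -/
theorem ncard_varNode_ne_le {ω ω' : Outcome M Y U n m dv dc ℓ} {t : ℕ} (h : ω.Near ω')
    (ht : t < ℓ) :
    {e : Edge n dv | ω.output e.1 ≠ ω'.output e.1 ∨
      ω.varNoise (⟨t, ht⟩, e.1) ≠ ω'.varNoise (⟨t, ht⟩, e.1)}.ncard ≤ 6 * dv := by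
  refine (Set.ncard_union_le {e : Edge n dv | e.1 ∈ {i | ω.output i ≠ ω'.output i}}
    {e : Edge n dv | e.1 ∈ {i | ω.varNoise (⟨t, ht⟩, i) ≠ ω'.varNoise (⟨t, ht⟩, i)}}).trans ?_
  have h₁ := (ncard_setOf_fst_mem_le (dv := dv) {i | ω.output i ≠ ω'.output i}).trans
    (Nat.mul_le_mul_left dv h.output)
  have h₂ := (ncard_setOf_fst_mem_le (dv := dv)
    {i | ω.varNoise (⟨t, ht⟩, i) ≠ ω'.varNoise (⟨t, ht⟩, i)}).trans
    (Nat.mul_le_mul_left dv ((ncard_slice_le _ _ _).trans h.varNoise))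
  omega

variable [MeasurableSpace Y] [MeasurableSpace U] (D : Decoder M Y U dv dc)
  {ω ω' : Outcome M Y U n m dv dc ℓ} {t : ℕ}

theorem ncard_receiveAtCheck_ne_le (h : ω.Near ω') (ht : t < ℓ) (ν ν' : Edge n dv → M) :
    {e | D.receiveAtCheck ω t ht ν e ≠ D.receiveAtCheck ω' t ht ν' e}.ncard ≤
      {e | ν e ≠ ν' e}.ncard + 3 := by
  refine (Set.ncard_le_ncard (t := {e | ν e ≠ ν' e} ∪
    {e | ω.wireToCheckNoise (⟨t, ht⟩, e) ≠ ω'.wireToCheckNoise (⟨t, ht⟩, e)}) ?_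
    (Set.toFinite _)).trans ((Set.ncard_union_le _ _).trans
      (Nat.add_le_add_left ((ncard_slice_le _ _ _).trans h.wireToCheckNoise) _))
  intro e he
  by_contra hne
  simp only [Set.mem_union, Set.mem_ofPred_eq, not_or, not_not] at hne
  exact he (by simp only [receiveAtCheck, hne])

theorem ncard_receiveAtVar_ne_le (h : ω.Near ω') (ht : t < ℓ) (ν ν' : Edge n dv → M) :
    {e | D.receiveAtVar ω t ht ν e ≠ D.receiveAtVar ω' t ht ν' e}.ncard ≤
      {e | ν e ≠ ν' e}.ncard + 3 := by
  refine (Set.ncard_le_ncard (t := {e | ν e ≠ ν' e} ∪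
    {e | ω.wireToVarNoise (⟨t, ht⟩, e) ≠ ω'.wireToVarNoise (⟨t, ht⟩, e)}) ?_
    (Set.toFinite _)).trans ((Set.ncard_union_le _ _).trans
      (Nat.add_le_add_left ((ncard_slice_le _ _ _).trans h.wireToVarNoise) _))
  intro e he
  by_contra hne
  simp only [Set.mem_union, Set.mem_ofPred_eq, not_or, not_not] at hne
  exact he (by simp only [receiveAtVar, hne])

theorem ncard_varInit_ne_le (h : ω.Near ω') (ht : 0 < ℓ) :
    {e : Edge n dv | D.varInit (ω.output e.1) (ω.varNoise (⟨0, ht⟩, e.1)) ≠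
      D.varInit (ω'.output e.1) (ω'.varNoise (⟨0, ht⟩, e.1))}.ncard ≤ 6 * dv := by
  refine (Set.ncard_le_ncard ?_ (Set.toFinite _)).trans (ncard_varNode_ne_le h ht)
  intro e he
  by_contra hne
  simp only [Set.mem_ofPred_eq, not_or, not_not] at hne
  exact he (by simp only [hne])

theorem ncard_varSend_ne_le (h : ω.Near ω') (ht : t < ℓ) (μ μ' : Edge n dv → M) :
    {e | D.varSend ω t ht μ e ≠ D.varSend ω' t ht μ' e}.ncard ≤
      dv * {e | μ e ≠ μ' e}.ncard + 6 * dv := by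
  refine (Set.ncard_le_ncard (t := {e : Edge n dv | ∃ a, (e.1, a) ∈ {e | μ e ≠ μ' e}} ∪
    {e : Edge n dv | ω.output e.1 ≠ ω'.output e.1 ∨
      ω.varNoise (⟨t, ht⟩, e.1) ≠ ω'.varNoise (⟨t, ht⟩, e.1)}) ?_
    (Set.toFinite _)).trans ((Set.ncard_union_le _ _).trans
      (Nat.add_le_add (ncard_setOf_exists_mem_le _) (ncard_varNode_ne_le h ht)))
  intro e he
  by_contra hne
  simp only [Set.mem_union, Set.mem_ofPred_eq, not_or, not_not, not_exists] at hne
  exact he (by simp only [varSend, hne])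

theorem ncard_checkSend_ne_le (h : ω.Near ω') (ht : t < ℓ) (μ μ' : Edge n dv → M) :
    {e | D.checkSend ω t ht μ e ≠ D.checkSend ω' t ht μ' e}.ncard ≤
      dc * ({e | μ e ≠ μ' e}.ncard + 6) + 3 := by
  -- The check sockets at which the messages arriving at the check nodes differ.
  set T : Set (Fin m × Fin dc) := {s | μ (ω.graph.edgeAt s) ≠ μ' (ω'.graph.edgeAt s)}
  have hT : T.ncard ≤ {e | μ e ≠ μ' e}.ncard + 3 := by
    have hsub : T ⊆ {s | μ (ω.graph.edgeAt s) ≠ μ' (ω.graph.edgeAt s)} ∪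
        {s | ω.graph.edgeAt s ≠ ω'.graph.edgeAt s} := by
      intro s hs
      by_contra hne
      simp only [Set.mem_union, Set.mem_ofPred_eq, not_or, not_not] at hne
      exact hs (by rw [hne.1, hne.2])
    refine (Set.ncard_le_ncard hsub (Set.toFinite _)).trans ((Set.ncard_union_le _ _).trans
      (Nat.add_le_add ?_ ((FactorGraph.ncard_edgeAt_ne_le _ _).trans h.graph)))
    rw [← Set.ncard_image_of_injective _ ω.graph.edgeAt_injective]
    refine Set.ncard_le_ncard ?_ (Set.toFinite _)
    rintro _ ⟨s, hs, rfl⟩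
    exact hs
  set N : Set (Fin m) := {j | ω.checkNoise (⟨t, ht⟩, j) ≠ ω'.checkNoise (⟨t, ht⟩, j)}
  have hN : N.ncard ≤ 3 := (ncard_slice_le _ _ _).trans h.checkNoise
  have hsub : {e | D.checkSend ω t ht μ e ≠ D.checkSend ω' t ht μ' e} ⊆
      ({e | ∃ b, ((ω.graph.checkSocket e).1, b) ∈ T} ∪ {e | (ω.graph.checkSocket e).1 ∈ N}) ∪
        {e | ω.graph.checkSocket e ≠ ω'.graph.checkSocket e} := by
    intro e he
    by_contra hne
    simp only [Set.mem_union, Set.mem_ofPred_eq, not_or, not_not, not_exists, T, N] at hne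
    refine he ?_
    simp only [checkSend, ← hne.2, hne.1]
  refine (Set.ncard_le_ncard hsub (Set.toFinite _)).trans ((Set.ncard_union_le _ _).trans
    (Nat.add_le_add ((Set.ncard_union_le _ _).trans ?_) h.graph))
  have h₁ := (ω.graph.ncard_setOf_exists_checkSocket_mem_le T).trans (Nat.mul_le_mul_left dc hT)
  have h₂ := (ω.graph.ncard_setOf_checkSocket_fst_mem_le N).trans (Nat.mul_le_mul_left dc hN)
  refine (Nat.add_le_add h₁ h₂).trans (le_of_eq ?_)
  ring

end Decoder

/-- A bound on the number of edges whose variable-to-check message of iteration `t` differs between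
two near outcomes. It does not depend on the size of the graph. -/
def spread (dv dc : ℕ) : ℕ → ℕ
  | 0 => 6 * dv + 3
  | t + 1 => dv * (dc * (spread dv dc t + 6) + 6) + 6 * dv + 3

variable [MeasurableSpace Y] [MeasurableSpace U] (D : Decoder M Y U dv dc)
  {ω ω' : Outcome M Y U n m dv dc ℓ}

theorem Decoder.ncard_received_ne_le (h : ω.Near ω') : ∀ (t : ℕ) (ht : t < ℓ),
    {e | (D.received ω t ht).1 e ≠ (D.received ω' t ht).1 e}.ncard ≤ spread dv dc t ∧
    {e | (D.received ω t ht).2 e ≠ (D.received ω' t ht).2 e}.ncard ≤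
      dc * (spread dv dc t + 6) + 6 := by
  have second : ∀ (t : ℕ) (ht : t < ℓ) (μ μ' : Edge n dv → M),
      {e | μ e ≠ μ' e}.ncard ≤ spread dv dc t →
      {e | D.receiveAtVar ω t ht (D.checkSend ω t ht μ) e ≠
        D.receiveAtVar ω' t ht (D.checkSend ω' t ht μ') e}.ncard ≤
          dc * (spread dv dc t + 6) + 6 := fun t ht μ μ' hμ =>
    (D.ncard_receiveAtVar_ne_le h ht _ _).trans <| Nat.add_le_add_right (k := 3) <|
      (D.ncard_checkSend_ne_le h ht μ μ').trans <| Nat.add_le_add_right (k := 3) <|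
        Nat.mul_le_mul_left dc <| Nat.add_le_add_right hμ 6
  intro t
  induction t with
  | zero =>
    intro ht
    have first := (D.ncard_receiveAtCheck_ne_le h ht _ _).trans
      (Nat.add_le_add_right (D.ncard_varInit_ne_le h ht) 3)
    exact ⟨first, second 0 ht _ _ first⟩
  | succ t ih =>
    intro ht
    have first := (D.ncard_receiveAtCheck_ne_le h ht _ _).trans <| Nat.add_le_add_right (k := 3) <|
      (D.ncard_varSend_ne_le h ht _ _).trans <| Nat.add_le_add_right (k := 6 * dv) <|
        Nat.mul_le_mul_left dv (ih (Nat.lt_of_succ_lt ht)).2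
    exact ⟨first, second (t + 1) ht _ _ first⟩

theorem numIncorrect_le_add (μ μ' : Edge n dv → M) :
    numIncorrect μ ≤ numIncorrect μ' + {e | μ e ≠ μ' e}.ncard := by
  classical
  unfold numIncorrect
  rw [← Set.ncard_coe_finset, ← Set.ncard_coe_finset]
  refine (Set.ncard_le_ncard ?_ (Set.toFinite _)).trans (Set.ncard_union_le _ _)
  intro e he
  by_cases heq : μ e = μ' e
  · left
    simpa [heq] using he
  · exact Or.inr heq

theorem numIncorrect_le (μ : Edge n dv → M) : numIncorrect μ ≤ n * dv := by
  classical
  refine (Finset.card_le_univ _).trans ?_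
  simp

theorem abs_numIncorrect_sub_le (μ μ' : Edge n dv → M) :
    |(numIncorrect μ : ℝ) - numIncorrect μ'| ≤ {e | μ e ≠ μ' e}.ncard := by
  have h₁ : (numIncorrect μ : ℝ) ≤ numIncorrect μ' + {e | μ e ≠ μ' e}.ncard :=
    mod_cast numIncorrect_le_add μ μ'
  have h₂ : (numIncorrect μ' : ℝ) ≤ numIncorrect μ + {e | μ e ≠ μ' e}.ncard := by
    have := numIncorrect_le_add μ' μ
    simp only [ne_comm (a := μ' _)] at this
    exact mod_cast this
  rw [abs_le]
  constructor <;> linarith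

/-- A bound, uniform in the size of the graph, on the change of the number of incorrect values
between near outcomes. -/
def lipschitzBound (dv dc ℓ : ℕ) : ℕ :=
  spread dv dc (ℓ - 1) + (dc * (spread dv dc (ℓ - 1) + 6) + 6)

theorem abs_incorrectValues_sub_le (hℓ : 0 < ℓ) (d : Direction) (h : ω.Near ω') :
    |incorrectValues D hℓ d ω - incorrectValues D hℓ d ω'| ≤ lipschitzBound dv dc ℓ := by
  have key := D.ncard_received_ne_le h (ℓ - 1) (Nat.sub_lt hℓ Nat.one_pos)
  cases d
  · exact (abs_numIncorrect_sub_le _ _).trans (mod_cast key.2.trans (Nat.le_add_left _ _))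
  · exact (abs_numIncorrect_sub_le _ _).trans (mod_cast key.1.trans (Nat.le_add_right _ _))

theorem abs_incorrectValues_le (hℓ : 0 < ℓ) (d : Direction) (ω : Outcome M Y U n m dv dc ℓ) :
    |incorrectValues D hℓ d ω| ≤ n * dv := by
  cases d <;>
  · rw [incorrectValues, abs_of_nonneg (Nat.cast_nonneg _)]
    exact mod_cast numIncorrect_le _

end Locality

/-! ### Measurability of the number of incorrect values -/

section Measurability

variable {M : Set EReal} {Y U : Type*} [MeasurableSpace Y] [MeasurableSpace U]
  {n m dv dc ℓ : ℕ}

instance (n m dv dc : ℕ) : DiscreteMeasurableSpace (FactorGraph n m dv dc) := ⟨fun _ => trivial⟩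

instance (n m dv dc : ℕ) : Finite (FactorGraph n m dv dc) :=
  inferInstanceAs (Finite ((Fin n × Fin dv) ≃ (Fin m × Fin dc)))

namespace Outcome

theorem measurable_output : Measurable (output : Outcome M Y U n m dv dc ℓ → _) := by
  unfold output; fun_prop

theorem measurable_varNoise : Measurable (varNoise : Outcome M Y U n m dv dc ℓ → _) := by
  unfold varNoise; fun_prop

theorem measurable_checkNoise : Measurable (checkNoise : Outcome M Y U n m dv dc ℓ → _) := by
  unfold checkNoise; fun_prop

theorem measurable_wireToCheckNoise :
    Measurable (wireToCheckNoise : Outcome M Y U n m dv dc ℓ → _) := by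
  unfold wireToCheckNoise; fun_prop

theorem measurable_wireToVarNoise :
    Measurable (wireToVarNoise : Outcome M Y U n m dv dc ℓ → _) := by
  unfold wireToVarNoise; fun_prop

end Outcome

namespace Decoder

open Outcome

variable (D : Decoder M Y U dv dc) {t : ℕ} {μ : Outcome M Y U n m dv dc ℓ → Edge n dv → M}

theorem measurable_receiveAtCheck (ht : t < ℓ) (hμ : Measurable μ) :
    Measurable fun ω => D.receiveAtCheck ω t ht (μ ω) :=
  measurable_pi_lambda _ fun e => D.measurable_wireToCheck.comp <|
    ((measurable_pi_apply e).comp hμ).prodMk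
      ((measurable_pi_apply ((⟨t, ht⟩ : Fin ℓ), e)).comp measurable_wireToCheckNoise)

theorem measurable_receiveAtVar (ht : t < ℓ) (hμ : Measurable μ) :
    Measurable fun ω => D.receiveAtVar ω t ht (μ ω) :=
  measurable_pi_lambda _ fun e => D.measurable_wireToVar.comp <|
    ((measurable_pi_apply e).comp hμ).prodMk
      ((measurable_pi_apply ((⟨t, ht⟩ : Fin ℓ), e)).comp measurable_wireToVarNoise)

theorem measurable_varSend (ht : t < ℓ) (hμ : Measurable μ) :
    Measurable fun ω => D.varSend ω t ht (μ ω) :=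
  measurable_pi_lambda _ fun e => (D.measurable_varMap t).comp <|
    ((measurable_pi_apply e.1).comp measurable_output).prodMk <|
      (measurable_pi_lambda _ fun k => (measurable_pi_apply (e.1, otherSocket e.2 k)).comp hμ).prodMk
        ((measurable_pi_apply ((⟨t, ht⟩ : Fin ℓ), e.1)).comp measurable_varNoise)

theorem measurable_checkSend (ht : t < ℓ) (hμ : Measurable μ) :
    Measurable fun ω => D.checkSend ω t ht (μ ω) := by
  -- The graph takes finitely many values, so it may be held fixed.
  refine measurable_from_prod_countable_right fun g => measurable_pi_lambda _ fun e => ?_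
  have hpair : Measurable fun x => ((g, x) : Outcome M Y U n m dv dc ℓ) := measurable_prodMk_left
  exact (D.measurable_checkMap t).comp <|
    (measurable_pi_lambda _ fun k => (measurable_pi_apply (g.edgeAt
      ((g.checkSocket e).1, otherSocket (g.checkSocket e).2 k))).comp (hμ.comp hpair)).prodMk
      ((measurable_pi_apply ((⟨t, ht⟩ : Fin ℓ), (g.checkSocket e).1)).comp
        (measurable_checkNoise.comp hpair))

theorem measurable_received : ∀ (t : ℕ) (ht : t < ℓ),
    Measurable fun ω : Outcome M Y U n m dv dc ℓ => D.received ω t ht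
  | 0, ht => by
    have first := D.measurable_receiveAtCheck (n := n) (m := m) ht <|
      measurable_pi_lambda _ fun e => D.measurable_varInit.comp <|
        ((measurable_pi_apply e.1).comp measurable_output).prodMk
          ((measurable_pi_apply ((⟨0, ht⟩ : Fin ℓ), e.1)).comp measurable_varNoise)
    exact first.prodMk (D.measurable_receiveAtVar ht (D.measurable_checkSend ht first))
  | t + 1, ht => by
    have first := D.measurable_receiveAtCheck ht <| D.measurable_varSend ht
      (measurable_received t (Nat.lt_of_succ_lt ht)).snd
    exact first.prodMk (D.measurable_receiveAtVar ht (D.measurable_checkSend ht first))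

end Decoder

theorem measurable_numIncorrect :
    Measurable fun μ : Edge n dv → M => (numIncorrect μ : ℝ) := by
  classical
  simp only [numIncorrect, Finset.card_filter, Nat.cast_sum]
  refine Finset.measurable_sum _ fun e _ => ?_
  have hval : Measurable fun μ : Edge n dv → M => (μ e : EReal) :=
    measurable_subtype_coe.comp (measurable_pi_apply e)
  have hset : MeasurableSet {μ : Edge n dv → M | ¬ (0 : EReal) < (μ e : EReal)} :=
    (measurableSet_lt measurable_const hval).compl
  have : Measurable fun μ : Edge n dv → M =>
      if ¬ (0 : EReal) < (μ e : EReal) then (1 : ℝ) else 0 :=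
    Measurable.ite hset measurable_const measurable_const
  convert this using 2
  split <;> simp

theorem measurable_incorrectValues (D : Decoder M Y U dv dc) (hℓ : 0 < ℓ) (d : Direction) :
    Measurable (incorrectValues (n := n) (m := m) D hℓ d) := by
  have h := D.measurable_received (n := n) (m := m) (ℓ - 1) (Nat.sub_lt hℓ Nat.one_pos)
  cases d
  · exact measurable_numIncorrect.comp h.snd
  · exact measurable_numIncorrect.comp h.fst

end Measurability

/-! ### Concentration under the law of the system -/

section Concentration

open BoundedDifferences
open scoped NNReal

variable {M : Set EReal} {Y U : Type*} [MeasurableSpace Y] [MeasurableSpace U]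
  {n m dv dc ℓ : ℕ}

theorem FactorGraph.nonempty (h : n * dv = m * dc) : Nonempty (FactorGraph n m dv dc) :=
  ⟨Fintype.equivOfCardEq (by simpa using h)⟩

theorem isProbabilityMeasure_law (N : Noise M Y U n m dv ℓ) (h : n * dv = m * dc) :
    IsProbabilityMeasure (law N dc) := by
  have := FactorGraph.nonempty h
  unfold law
  infer_instance

theorem concentrates_factorGraph (h : n * dv = m * dc) :
    Concentrates (uniformOn (Set.univ : Set (FactorGraph n m dv dc)))
      (fun g g' => {e | g.checkSocket e ≠ g'.checkSocket e}.ncard ≤ 3) ((n * dv : ℕ) / 4) := by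
  obtain ⟨g⟩ := FactorGraph.nonempty h
  let _ : MeasurableSpace ((Fin n × Fin dv) ≃ (Fin m × Fin dc)) := ⊤
  have : DiscreteMeasurableSpace ((Fin n × Fin dv) ≃ (Fin m × Fin dc)) := ⟨fun _ => trivial⟩
  have := concentrates_equiv (α := Fin n × Fin dv) (β := Fin m × Fin dc) g
  simp only [Fintype.card_prod, Fintype.card_fin] at this
  exact this

theorem concentrates_law (N : Noise M Y U n m dv ℓ) (h : n * dv = m * dc) :
    Concentrates (law N dc) Outcome.Near
      ((n * dv : ℕ) / 4 + (n / 4 + ((ℓ * n : ℕ) / 4 + ((ℓ * m : ℕ) / 4 +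
        ((ℓ * (n * dv) : ℕ) / 4 + (ℓ * (n * dv) : ℕ) / 4))))) := by
  have := FactorGraph.nonempty h
  have h₀ := concentrates_factorGraph h
  have h₁ := concentrates_pi (k := 3) (fun i => (N.channel i 1 : Measure Y)) (by norm_num)
  have h₂ := concentrates_pi (k := 3) (fun i => (N.varNoise i : Measure U)) (by norm_num)
  have h₃ := concentrates_pi (k := 3) (fun i => (N.checkNoise i : Measure U)) (by norm_num)
  have h₄ := concentrates_pi (k := 3) (fun i => (N.wireToCheckNoise i : Measure M)) (by norm_num)
  have h₅ := concentrates_pi (k := 3) (fun i => (N.wireToVarNoise i : Measure M)) (by norm_num)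
  simp only [Fintype.card_prod, Fintype.card_fin] at h₁ h₂ h₃ h₄ h₅
  have p₄ := h₄.prod h₅ (T := fun p q => {i | p.1 i ≠ q.1 i}.ncard ≤ 3 ∧
    {i | p.2 i ≠ q.2 i}.ncard ≤ 3)
    (fun a a' b haa => ⟨haa, by simp⟩) (fun a b b' hbb => ⟨by simp, hbb⟩)
  have p₃ := h₃.prod p₄ (T := fun p q => {i | p.1 i ≠ q.1 i}.ncard ≤ 3 ∧
    {i | p.2.1 i ≠ q.2.1 i}.ncard ≤ 3 ∧ {i | p.2.2 i ≠ q.2.2 i}.ncard ≤ 3)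
    (fun a a' b haa => ⟨haa, by simp⟩) (fun a b b' hbb => ⟨by simp, hbb⟩)
  have p₂ := h₂.prod p₃ (T := fun p q => {i | p.1 i ≠ q.1 i}.ncard ≤ 3 ∧
    {i | p.2.1 i ≠ q.2.1 i}.ncard ≤ 3 ∧ {i | p.2.2.1 i ≠ q.2.2.1 i}.ncard ≤ 3 ∧
    {i | p.2.2.2 i ≠ q.2.2.2 i}.ncard ≤ 3)
    (fun a a' b haa => ⟨haa, by simp⟩) (fun a b b' hbb => ⟨by simp, hbb⟩)
  have p₁ := h₁.prod p₂ (T := fun p q => {i | p.1 i ≠ q.1 i}.ncard ≤ 3 ∧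
    {i | p.2.1 i ≠ q.2.1 i}.ncard ≤ 3 ∧ {i | p.2.2.1 i ≠ q.2.2.1 i}.ncard ≤ 3 ∧
    {i | p.2.2.2.1 i ≠ q.2.2.2.1 i}.ncard ≤ 3 ∧ {i | p.2.2.2.2 i ≠ q.2.2.2.2 i}.ncard ≤ 3)
    (fun a a' b haa => ⟨haa, by simp⟩) (fun a b b' hbb => ⟨by simp, hbb⟩)
  refine h₀.prod p₁ (fun g g' x hg => ?_) (fun g x y hxy => ?_)
  · constructor <;> first | exact hg | simp [Outcome.output, Outcome.varNoise, Outcome.checkNoise,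
      Outcome.wireToCheckNoise, Outcome.wireToVarNoise]
  · obtain ⟨o, v, c, w, w'⟩ := hxy
    exact ⟨by simp [Outcome.graph], o, v, c, w, w'⟩

end Concentration

end NoisyLDPC

theorem theorem2 (dv dc ℓ : ℕ) (hℓ : 0 < ℓ) :
    ∃ β : ℝ, 0 < β ∧
      ∀ (n m : ℕ), n * dv = m * dc →
      ∀ (M : Set EReal) (Y U : Type*) [MeasurableSpace Y] [MeasurableSpace U]
        (D : NoisyLDPC.Decoder M Y U dv dc) (N : NoisyLDPC.Noise M Y U n m dv ℓ)
        (d : NoisyLDPC.Direction),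
        Integrable (NoisyLDPC.incorrectValues D hℓ d) (NoisyLDPC.law N dc) ∧
        ∀ ε : ℝ, 0 < ε →
          (NoisyLDPC.law N dc).real
              {ω | (n : ℝ) * dv * ε / 2 <
                |NoisyLDPC.incorrectValues D hℓ d ω -
                  ∫ ω', NoisyLDPC.incorrectValues D hℓ d ω' ∂(NoisyLDPC.law N dc)|} ≤
            2 * Real.exp (-β * ε ^ 2 * n) := by
  set C : ℝ := (NoisyLDPC.lipschitzBound dv dc ℓ : ℝ) with hC_def
  have hC : 0 < C := by
    rw [hC_def, NoisyLDPC.lipschitzBound]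
    positivity
  -- For `dv, dc ≥ 1` there are at most `n * K` independent sources of randomness, each of variance
  -- proxy `1 / 4`, because then `m ≤ n * dv`.
  set K : ℝ := dv + 1 + ℓ + 3 * (ℓ * dv) with hK_def
  have hK : 0 < K := by positivity
  refine ⟨1 / (2 * C ^ 2 * K), by positivity, ?_⟩
  intro n m hnm M Y U _ _ D N d
  have := NoisyLDPC.isProbabilityMeasure_law N hnm
  have hmeas := NoisyLDPC.measurable_incorrectValues (n := n) (m := m) D hℓ d
  have hbound := NoisyLDPC.abs_incorrectValues_le (n := n) (m := m) D hℓ d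
  refine ⟨.of_bound hmeas.aestronglyMeasurable _ (ae_of_all _ hbound), fun ε hε => ?_⟩
  obtain h0 | hpos := Nat.eq_zero_or_pos (n * dv)
  · -- A graph without edges: the number of incorrect values vanishes.
    have hzero : ∀ ω, NoisyLDPC.incorrectValues (n := n) (m := m) D hℓ d ω = 0 := fun ω => by
      have := hbound ω
      rw [← Nat.cast_mul, h0, Nat.cast_zero] at this
      exact abs_nonpos_iff.1 this
    have h0' : (n : ℝ) * dv = 0 := mod_cast h0
    simp only [hzero, h0']
    simp only [zero_mul, zero_div, integral_zero, sub_zero, abs_zero, lt_self_iff_false,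
      Set.ofPred_false, measureReal_empty]
    positivity
  have hn : 0 < n := Nat.pos_of_mul_pos_right hpos
  have hdv : 1 ≤ dv := Nat.pos_of_mul_pos_left hpos
  have hdc : 1 ≤ dc := Nat.pos_of_mul_pos_left (hnm ▸ hpos)
  have hm : (m : ℝ) ≤ n * dv := mod_cast (Nat.le_mul_of_pos_right m hdc).trans hnm.ge
  refine ((NoisyLDPC.concentrates_law N hnm).measureReal_abs_sub_gt_le hmeas hbound hC
    (fun ω ω' h => NoisyLDPC.abs_incorrectValues_sub_le D hℓ d h) (by positivity)).trans ?_
  have hn' : (0 : ℝ) < n := mod_cast hn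
  have hdv' : (1 : ℝ) ≤ dv := mod_cast hdv
  gcongr
  push_cast
  set V : ℝ := n * dv / 4 + (n / 4 + (ℓ * n / 4 + (ℓ * m / 4 +
    (ℓ * (n * dv) / 4 + ℓ * (n * dv) / 4)))) with hV_def
  have hV : V ≤ n * K / 4 := by
    have : (ℓ : ℝ) * m ≤ ℓ * (n * dv) := by gcongr
    rw [hV_def, hK_def]
    linarith
  have hVpos : 0 < V := by positivity
  rw [neg_div, neg_mul, neg_mul, neg_le_neg_iff]
  calc 1 / (2 * C ^ 2 * K) * ε ^ 2 * n
      = (n * 1 * ε / 2 / C) ^ 2 / (2 * (n * K / 4)) := by field_simp; norm_num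
    _ ≤ (n * dv * ε / 2 / C) ^ 2 / (2 * V) := by gcongr
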